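/- Let $A$ be a set. For $n\ge 1$ let $A^n_2$ be the set of tuples in $A^n$ with at most two distinct entries. An $n$-ary 2-function on $A$ is a map $g:A^n_2\to A$; it is conservative if $g(x_1,\dots,x_n)\in\{x_1,\dots,x_n\}$ for all $(x_1,\dots,x_n)\in A^n_2$. For a permutation $\sigma$ of $A$ put $g_\sigma(x_1,\dots,x_n)=\sigma^{-1}(g(\sigma(x_1),\dots,\sigma(x_n)))$. A 2-clone on $A$ is a set of 2-functions on $A$ (of arities $n\ge 1$) that contains all projections and is closed under superposition (whenever the superposition is defined on all of $A^n_2$). It is conservative if all its members are conservative, and symmetric if it contains $g_\sigma$ for each of its members $g$ and each permutation $\sigma$ of $A$. Consider the following clones of Boolean functions: $O_1$, generated by $x$; $D_1$, generated by $xy\vee yz\vee xz$ and $x\oplus y\oplus z$; $D_2$, generated by $xy\vee yz\vee xz$; $L_4$, generated by $x\oplus y\oplus z$; $A_4$, generated by $xy$ and $x\vee y$; and $C_4$, the clone of all Boolean functions $f$ with $f(0,\dots,0)=0$ and $f(1,\dots,1)=1$. For such a clone $H$, the free extension of $H$ to $A$ is the set of all 2-functions $g$ on $A$ (of arities $n\ge1$)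 such that for every two-element set $b\subseteq A$ there are an $n$-ary $h\in H$ and a bijection $\sigma:b\to\{0,1\}$ with $$g(x_1,\dots,x_n)=\sigma^{-1}(h(\sigma(x_1),\dots,\sigma(x_n)))\quad\text{for all }x_1,\dots,x_n\in b.$$ The dependent extension of $H$ to $A$ is the set of all 2-functions $g$ on $A$ (of arities $n\ge1$) for which there is a single $n$-ary $h\in H$ such that this equality holds for every two-element set $b\subseteq A$, every bijection $\sigma:b\to\{0,1\}$ and all $x_1,\dots,x_n\in b$. **Theorem 2.** Let $5\le |A|<\omega$ and let $G$ be a symmetric conservative 2-clone on $A$. Then one of the following two conditions holds: 1. $G$ contains a binary function that is not a projection, and $G$ is the free extension to $A$ of one of the clones $O_1, D_1, D_2, L_4, A_4, C_4$; 2. every binary function in $G$ is a projection, and $G$ is the dependent extension to $A$ of one of the clones $O_1, D_1, D_2, L_4$. -/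

import Mathlib

/-- A Boolean function of arity `n`. -/
abbrev BoolFun (n : ℕ) : Type := (Fin n → Bool) → Bool

/-- A set of Boolean functions, sorted by arity. -/
abbrev BoolClass : Type := (n : ℕ) → Set (BoolFun n)

/-- `BoolGenerated F n f`: the `n`-ary Boolean function `f` is obtained from projections and
members of `F` by superposition. -/
inductive BoolGenerated (F : Set (Σ n : ℕ, BoolFun n)) : (n : ℕ) → BoolFun n → Prop
  | proj (n : ℕ) (i : Fin n) : BoolGenerated F n (fun x => x i)
  | basic (n : ℕ) (f : BoolFun n) (hf : (⟨n, f⟩ : Σ n : ℕ, BoolFun n) ∈ F) :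
      BoolGenerated F n f
  | comp (m n : ℕ) (f : BoolFun m) (g : Fin m → BoolFun n)
      (hf : BoolGenerated F m f) (hg : ∀ i, BoolGenerated F n (g i)) :
      BoolGenerated F n (fun x => f (fun i => g i x))

/-- The clone of Boolean functions generated by `F`. -/
def boolClone (F : Set (Σ n : ℕ, BoolFun n)) : BoolClass :=
  fun n => {f | BoolGenerated F n f}

namespace PostClass

/-- The identity function `x`. -/
def idFun : BoolFun 1 := fun x => x 0

/-- The conjunction `xy`. -/
def conj : BoolFun 2 := fun x => x 0 && x 1

/-- The disjunction `x ∨ y`. -/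
def disj : BoolFun 2 := fun x => x 0 || x 1

/-- The majority function `xy ∨ yz ∨ xz`. -/
def maj : BoolFun 3 := fun x => (x 0 && x 1) || (x 1 && x 2) || (x 0 && x 2)

/-- The ternary sum `x ⊕ y ⊕ z` modulo 2. -/
def sum3 : BoolFun 3 := fun x => xor (xor (x 0) (x 1)) (x 2)

/-- Post's class `O₁`, generated by `x`. -/
def O1 : BoolClass := boolClone {⟨1, idFun⟩}

/-- Post's class `D₁`, generated by `xy ∨ yz ∨ xz` and `x ⊕ y ⊕ z`. -/
def D1 : BoolClass := boolClone {⟨3, maj⟩, ⟨3, sum3⟩}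

/-- Post's class `D₂`, generated by `xy ∨ yz ∨ xz`. -/
def D2 : BoolClass := boolClone {⟨3, maj⟩}

/-- Post's class `L₄`, generated by `x ⊕ y ⊕ z`. -/
def L4 : BoolClass := boolClone {⟨3, sum3⟩}

/-- Post's class `A₄`, generated by `xy` and `x ∨ y`. -/
def A4 : BoolClass := boolClone {⟨2, conj⟩, ⟨2, disj⟩}

/-- Post's class `C₄`: all Boolean functions that preserve `0` and `1`. (No function of arity `0`
satisfies both conditions.) -/
def C4 : BoolClass :=
  fun _ => {f | f (fun _ => false) = false ∧ f (fun _ => true) = true}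

end PostClass

/-- The set `A₂ⁿ` of `n`-tuples of elements of `A` with at most two distinct entries. -/
def TwoTuple (A : Type*) (n : ℕ) : Type _ :=
  {x : Fin n → A // (Set.range x).ncard ≤ 2}

/-- An `n`-ary `2`-function on `A`. -/
abbrev TwoFun (A : Type*) (n : ℕ) : Type _ := TwoTuple A n → A

namespace TwoTuple

/-- The image `(σ x₁, …, σ xₙ)` of a tuple under a permutation. -/
def map {A : Type*} {n : ℕ} (σ : Equiv.Perm A) (x : TwoTuple A n) : TwoTuple A n :=
  ⟨fun i => σ (x.1 i), by
    have h : Set.range (fun i => σ (x.1 i)) = σ '' Set.range x.1 := Set.range_comp σ x.1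
    rw [h, Set.ncard_image_of_injective _ σ.injective]
    exact x.2⟩

end TwoTuple

namespace TwoFun

/-- The projection to the `i`-th coordinate. -/
def proj (A : Type*) {n : ℕ} (i : Fin n) : TwoFun A n := fun x => x.1 i

/-- `g` is a projection. -/
def IsProjection {A : Type*} {n : ℕ} (g : TwoFun A n) : Prop := ∃ i : Fin n, g = proj A i

/-- `g` is conservative: its value is always one of its arguments. -/
def IsConservative {A : Type*} {n : ℕ} (g : TwoFun A n) : Prop :=
  ∀ x : TwoTuple A n, ∃ i : Fin n, g x = x.1 i

/-- The `2`-function `g_σ`, `g_σ(x₁, …, xₙ) = σ⁻¹(g(σ x₁, …, σ xₙ))`. -/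
def conjBy {A : Type*} {n : ℕ} (σ : Equiv.Perm A) (g : TwoFun A n) : TwoFun A n :=
  fun x => σ.symm (g (x.map σ))

/-- `g` acts on the subset `b` of `A` as the Boolean function `h`, when `b` is identified with
`{0, 1}` by `σ`: `g(x₁, …, xₙ) = σ⁻¹(h(σ x₁, …, σ xₙ))` for all `x₁, …, xₙ ∈ b`. -/
def ActsAs {A : Type*} {n : ℕ} (g : TwoFun A n) (b : Set A) (σ : b ≃ Bool) (h : BoolFun n) :
    Prop :=
  ∀ (x : TwoTuple A n) (hx : ∀ i, x.1 i ∈ b),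
    g x = (σ.symm (h (fun i => σ ⟨x.1 i, hx i⟩)) : A)

/-- `g` is freely associated with `H`. -/
def FreelyAssociated {A : Type*} {n : ℕ} (g : TwoFun A n) (H : BoolClass) : Prop :=
  ∀ b : Set A, b.ncard = 2 → ∃ h ∈ H n, ∃ σ : b ≃ Bool, g.ActsAs b σ h

/-- `g` is dependently associated with `H`. -/
def DependentlyAssociated {A : Type*} {n : ℕ} (g : TwoFun A n) (H : BoolClass) : Prop :=
  ∃ h ∈ H n, ∀ b : Set A, b.ncard = 2 → ∀ σ : b ≃ Bool, g.ActsAs b σ h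

end TwoFun

/-- A set of `2`-functions on `A`, sorted by arity. -/
abbrev TwoClass (A : Type*) : Type _ := (n : ℕ) → Set (TwoFun A n)

namespace TwoClass

/-- `G` is a `2`-clone: it consists of `2`-functions of arities `n ≥ 1`, contains all projections,
and contains every superposition of its members that is defined on all of `A₂ⁿ`. -/
structure IsTwoClone {A : Type*} (G : TwoClass A) : Prop where
  arity_pos : ∀ (n : ℕ), ∀ g ∈ G n, 1 ≤ n
  proj_mem : ∀ (n : ℕ) (i : Fin n), TwoFun.proj A i ∈ G n
  comp_mem : ∀ (m n : ℕ) (f : TwoFun A m) (g : Fin m → TwoFun A n)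
    (hd : ∀ x : TwoTuple A n, (Set.range (fun i => g i x)).ncard ≤ 2),
    f ∈ G m → (∀ i, g i ∈ G n) → (fun x => f ⟨fun i => g i x, hd x⟩) ∈ G n

/-- `G` contains only conservative `2`-functions. -/
def IsConservative {A : Type*} (G : TwoClass A) : Prop :=
  ∀ (n : ℕ), ∀ g ∈ G n, g.IsConservative

/-- `G` contains `g_σ` for every `g ∈ G` and every permutation `σ` of `A`. -/
def IsSymmetric {A : Type*} (G : TwoClass A) : Prop :=
  ∀ (n : ℕ), ∀ g ∈ G n, ∀ σ : Equiv.Perm A, g.conjBy σ ∈ G n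

/-- The free extension of `H` to `A`. -/
def freeExtension (H : BoolClass) (A : Type*) : TwoClass A :=
  fun n => {g | 1 ≤ n ∧ g.FreelyAssociated H}

/-- The dependent extension of `H` to `A`. -/
def dependentExtension (H : BoolClass) (A : Type*) : TwoClass A :=
  fun n => {g | 1 ≤ n ∧ g.DependentlyAssociated H}

end TwoClass

/-!
A `2`-clone `G` that is conservative is closed under all superpositions, and a member of `G` is
determined by the Boolean functions by which it acts on the two-element subsets of `A`. So `G` is a
clone of families of idempotent Boolean functions indexed by the pairs in `A`, and by symmetry all
pairs carry the same clone `K` of Boolean functions (`TwoClass.restrict`), which is idempotent and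
closed under duality. It remains to identify `K` and to see how the actions of a member of `G` on
different pairs depend on each other.

*The clone `K`.* If `K` has a binary semilattice operation, then by duality it contains conjunction
and disjunction, hence majority. By the Baker–Pixley property
(`IsBoolClone.mem_of_interpolation`) membership in a clone with majority is a matter of
interpolation at two points, which makes `K` equal to `A₄` or `C₄` according to whether its members
are monotone. Otherwise all members of `K` are self-dual. With majority, interpolation at two points
gives `D₂` or `D₁`; without majority, all members of `K` are sums of odd numbers of variables
(`IsBoolClone.exists_eq_parity`), and `K` is `O₁` or `L₄`.

*Dependence between pairs.* If all binary members of `G` are projections, then identifying variables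
shows that each member acts in the same way on all pairs, under all identifications with `{0, 1}`
(`TwoClass.restrict_eq_restrict`), so `G` is the dependent extension of `K`. If some binary member
is not a projection, then for any two distinct pairs some binary member is the first projection on
one and the second projection on the other (`IsSymmBinaryClone.exists_separating`). When some binary
member is commutative on some pair, there is one that is commutative everywhere, that is, a
tournament; the tournaments obtained from it by permuting `A` realize all combinations of the
lattice operations on the two pairs, and absorption does the rest. When all binary members act on
each pair as projections, inseparability is an invariant equivalence relation on the pairs, and such
a relation is trivial because `A` has at least five points. Separation allows the actions on the
individual pairs to be chosen independently (`TwoClass.mem_of_restrict_mem`), so `G` is the free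
extension of `K`.
-/

/-! ### Clones of Boolean functions and interpolation -/

/-- `K` is a clone of Boolean functions: it contains the projections and is closed under
superposition. -/
structure IsBoolClone (K : BoolClass) : Prop where
  proj_mem : ∀ (n : ℕ) (i : Fin n), (fun x => x i) ∈ K n
  comp_mem : ∀ (m n : ℕ) (f : BoolFun m) (g : Fin m → BoolFun n),
    f ∈ K m → (∀ i, g i ∈ K n) → (fun x => f (fun i => g i x)) ∈ K n

theorem isBoolClone_boolClone (F : Set (Σ n : ℕ, BoolFun n)) : IsBoolClone (boolClone F) :=
  ⟨.proj, .comp⟩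

/-- `boolClone F` is the least clone containing `F`. -/
theorem IsBoolClone.boolClone_subset {K : BoolClass} (hK : IsBoolClone K)
    {F : Set (Σ n : ℕ, BoolFun n)} (hF : ∀ p ∈ F, p.2 ∈ K p.1) (n : ℕ) :
    boolClone F n ⊆ K n := by
  intro f hf
  induction hf with
  | proj n i => exact hK.proj_mem n i
  | basic n f hf => exact hF _ hf
  | comp m n f g _ _ ihf ihg => exact hK.comp_mem m n f g ihf ihg

namespace BoolFun

/-- `f` preserves both constants. There is no idempotent function of arity `0`. -/
def IsIdempotent {n : ℕ} (f : BoolFun n) : Prop := ∀ c, f (fun _ => c) = c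

/-- `f` commutes with negation. -/
def IsSelfDual {n : ℕ} (f : BoolFun n) : Prop := ∀ x, f (fun i => !x i) = !f x

/-- The dual function `¬f(¬x₁, …, ¬xₙ)`. -/
def dual {n : ℕ} (f : BoolFun n) : BoolFun n := fun x => !f (fun i => !x i)

theorem IsIdempotent.exists_apply_eq {n : ℕ} {f : BoolFun n} (hf : f.IsIdempotent)
    {a : Fin n → Bool} {c : Bool} (h : f a = c) : ∃ i, a i = c := by
  by_contra! hne
  have : a = fun _ => !c := funext fun i => by
    have := hne i
    revert this; cases a i <;> cases c <;> simp
  rw [this, hf] at h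
  cases c <;> simp at h

/-- A ternary self-dual idempotent function is determined by its values at the unit vectors. -/
theorem ext_unit_vectors {f g : BoolFun 3} (hf : f.IsIdempotent) (hf' : f.IsSelfDual)
    (hg : g.IsIdempotent) (hg' : g.IsSelfDual)
    (h0 : f ![true, false, false] = g ![true, false, false])
    (h1 : f ![false, true, false] = g ![false, true, false])
    (h2 : f ![false, false, true] = g ![false, false, true]) : f = g := by
  have hneg : ∀ x, f x = g x → f (fun i => !x i) = g (fun i => !x i) := fun x h => by
    rw [hf' x, hg' x, h]
  have k0 := hneg _ h0
  have k1 := hneg _ h1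
  have k2 := hneg _ h2
  have hc : ∀ c, f (fun _ => c) = g (fun _ => c) := fun c => by rw [hf c, hg c]
  have vec : ∀ (x : Fin 3 → Bool), x = ![x 0, x 1, x 2] := fun x => by
    ext i; fin_cases i <;> rfl
  funext x
  rw [vec (fun i => !(![true, false, false] : Fin 3 → Bool) i)] at k0
  rw [vec (fun i => !(![false, true, false] : Fin 3 → Bool) i)] at k1
  rw [vec (fun i => !(![false, false, true] : Fin 3 → Bool) i)] at k2
  have ht := hc true
  have hb := hc false
  rw [vec (fun _ => true)] at ht
  rw [vec (fun _ => false)] at hb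
  simp only [Matrix.cons_val_zero, Matrix.cons_val_one, Matrix.cons_val, Bool.not_true,
    Bool.not_false] at k0 k1 k2
  rw [vec x]
  cases x 0 <;> cases x 1 <;> cases x 2 <;> assumption

end BoolFun

namespace IsBoolClone

open PostClass

variable {K : BoolClass} (hK : IsBoolClone K) {n : ℕ}
include hK

theorem comp₂ {f : BoolFun 2} (hf : f ∈ K 2) {g h : BoolFun n} (hg : g ∈ K n) (hh : h ∈ K n) :
    (fun x => f ![g x, h x]) ∈ K n := by
  have := hK.comp_mem 2 n f ![g, h] hf (by intro i; fin_cases i <;> assumption)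
  convert this using 3 with x
  ext i; fin_cases i <;> rfl

theorem comp₃ {f : BoolFun 3} (hf : f ∈ K 3) {g h k : BoolFun n} (hg : g ∈ K n) (hh : h ∈ K n)
    (hk : k ∈ K n) : (fun x => f ![g x, h x, k x]) ∈ K n := by
  have := hK.comp_mem 3 n f ![g, h, k] hf (by intro i; fin_cases i <;> assumption)
  convert this using 3 with x
  ext i; fin_cases i <;> rfl

/-- `K` is closed under identification, permutation and addition of variables. -/
theorem minor {m : ℕ} {f : BoolFun m} (hf : f ∈ K m) (s : Fin m → Fin n) :
    (fun x => f (fun i => x (s i))) ∈ K n :=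
  hK.comp_mem m n f (fun i x => x (s i)) hf fun i => hK.proj_mem n (s i)

theorem and_mem (h : conj ∈ K 2) {f g : BoolFun n} (hf : f ∈ K n) (hg : g ∈ K n) :
    (fun x => f x && g x) ∈ K n := hK.comp₂ h hf hg

theorem or_mem (h : disj ∈ K 2) {f g : BoolFun n} (hf : f ∈ K n) (hg : g ∈ K n) :
    (fun x => f x || g x) ∈ K n := hK.comp₂ h hf hg

theorem maj_mem_of_lattice (hc : conj ∈ K 2) (hd : disj ∈ K 2) : maj ∈ K 3 :=
  hK.or_mem hd (hK.or_mem hd (hK.and_mem hc (hK.proj_mem 3 0) (hK.proj_mem 3 1))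
    (hK.and_mem hc (hK.proj_mem 3 1) (hK.proj_mem 3 2)))
    (hK.and_mem hc (hK.proj_mem 3 0) (hK.proj_mem 3 2))

/-- The Baker–Pixley interpolation property: a clone with a majority operation contains every
function that it interpolates at any two points. -/
theorem mem_of_interpolation (hm : maj ∈ K 3) {h : BoolFun n}
    (H : ∀ a b, ∃ k ∈ K n, k a = h a ∧ k b = h b) : h ∈ K n := by
  classical
  have key : ∀ (m : ℕ) (S : Finset (Fin n → Bool)), S.card ≤ m →
      ∃ k ∈ K n, ∀ a ∈ S, k a = h a := by
    intro m
    induction m with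
    | zero =>
      intro S hS
      obtain ⟨k, hk, -⟩ := H (fun _ => true) (fun _ => true)
      refine ⟨k, hk, fun a ha => ?_⟩
      simp_all
    | succ m ih =>
      intro S hS
      by_cases h2 : 2 < S.card
      · obtain ⟨a, b, c, ha, hb, hc, hab, hac, hbc⟩ := Finset.two_lt_card_iff.1 h2
        have er : ∀ d ∈ S, ∃ k ∈ K n, ∀ a ∈ S.erase d, k a = h a := fun d hd =>
          ih _ (by rw [Finset.card_erase_of_mem hd]; omega)
        obtain ⟨ka, hka, Ha⟩ := er a ha
        obtain ⟨kb, hkb, Hb⟩ := er b hb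
        obtain ⟨kc, hkc, Hc⟩ := er c hc
        refine ⟨_, hK.comp₃ hm hka hkb hkc, fun x hx => ?_⟩
        -- each point of `S` is missed by at most one of the three interpolants
        have h1 : x ≠ a → ka x = h x := fun hne => Ha x (Finset.mem_erase.2 ⟨hne, hx⟩)
        have h2 : x ≠ b → kb x = h x := fun hne => Hb x (Finset.mem_erase.2 ⟨hne, hx⟩)
        have h3 : x ≠ c → kc x = h x := fun hne => Hc x (Finset.mem_erase.2 ⟨hne, hx⟩)
        simp only [maj, Matrix.cons_val_zero, Matrix.cons_val_one, Matrix.cons_val]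
        by_cases xa : x = a
        · rw [h2 (xa ▸ hab), h3 (xa ▸ hac)]; cases ka x <;> cases h x <;> rfl
        by_cases xb : x = b
        · rw [h1 xa, h3 (xb ▸ hbc)]; cases kb x <;> cases h x <;> rfl
        · rw [h1 xa, h2 xb]; cases kc x <;> cases h x <;> rfl
      · have : ∃ a b, S ⊆ {a, b} := by
          rcases S.eq_empty_or_nonempty with rfl | ⟨a, ha⟩
          · exact ⟨fun _ => true, fun _ => true, by simp⟩
          · have h1 : (S.erase a).card ≤ 1 := by rw [Finset.card_erase_of_mem ha]; omega
            obtain ⟨b, hb⟩ := Finset.card_le_one_iff_subset_singleton.1 h1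
            exact ⟨a, b, by rw [← Finset.insert_erase ha]; exact Finset.insert_subset_insert a hb⟩
        obtain ⟨a, b, hS⟩ := this
        obtain ⟨k, hk, h1, h2⟩ := H a b
        refine ⟨k, hk, fun x hx => ?_⟩
        have := hS hx
        simp only [Finset.mem_insert, Finset.mem_singleton] at this
        rcases this with rfl | rfl <;> assumption
  obtain ⟨k, hk, H⟩ := key _ Finset.univ le_rfl
  rwa [← funext fun a => H a (Finset.mem_univ a)]

/-- A non-monotone member has a ternary minor that is non-monotone on the chain
`001 < 011`. -/
theorem exists_ternary_of_not_monotone {f : BoolFun n} (hf : f ∈ K n) (hmono : ¬ Monotone f) :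
    ∃ p ∈ K 3, p ![false, false, true] = true ∧ p ![false, true, true] = false := by
  simp only [Monotone, not_forall] at hmono
  obtain ⟨a, b, hab, h⟩ := hmono
  have hfa : f a = true ∧ f b = false := by
    revert h; cases f a <;> cases f b <;> simp
  refine ⟨_, hK.minor hf (fun i => if b i then if a i then 2 else 1 else 0), ?_, ?_⟩
  · refine (congrArg f (funext fun i => ?_)).trans hfa.1
    have := hab i
    revert this; cases a i <;> cases b i <;> simp
  · refine (congrArg f (funext fun i => ?_)).trans hfa.2
    have := hab i
    revert this; cases a i <;> cases b i <;> simp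

/-- A clone containing the lattice operations interpolates every idempotent function at `a`, `b`,
unless the function decreases along `a ≤ b`. -/
theorem exists_interpolant_of_lattice (hc : conj ∈ K 2) (hd : disj ∈ K 2) {h : BoolFun n}
    (hh : h.IsIdempotent)
    (hdec : ∀ a b, a ≤ b → h a = true → h b = false → ∃ k ∈ K n, k a = true ∧ k b = false)
    (a b : Fin n → Bool) : ∃ k ∈ K n, k a = h a ∧ k b = h b := by
  have dec : ∀ a b, h a = true → h b = false → ∃ k ∈ K n, k a = true ∧ k b = false := by
    intro a b ha hb
    by_cases hab : a ≤ b
    · exact hdec a b hab ha hb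
    · simp only [Pi.le_def, not_forall] at hab
      obtain ⟨i, hi⟩ := hab
      refine ⟨_, hK.proj_mem n i, ?_⟩
      revert hi; cases a i <;> cases b i <;> simp
  cases ha : h a <;> cases hb : h b
  · obtain ⟨i, hi⟩ := hh.exists_apply_eq ha
    obtain ⟨j, hj⟩ := hh.exists_apply_eq hb
    exact ⟨_, hK.and_mem hc (hK.proj_mem n i) (hK.proj_mem n j), by simp [hi], by simp [hj]⟩
  · obtain ⟨k, hk, h1, h2⟩ := dec b a hb ha
    exact ⟨k, hk, h2, h1⟩
  · exact dec a b ha hb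
  · obtain ⟨i, hi⟩ := hh.exists_apply_eq ha
    obtain ⟨j, hj⟩ := hh.exists_apply_eq hb
    exact ⟨_, hK.or_mem hd (hK.proj_mem n i) (hK.proj_mem n j), by simp [hi], by simp [hj]⟩

theorem mem_of_lattice_of_monotone (hc : conj ∈ K 2) (hd : disj ∈ K 2) {h : BoolFun n}
    (hh : h.IsIdempotent) (hmono : Monotone h) : h ∈ K n := by
  refine hK.mem_of_interpolation (hK.maj_mem_of_lattice hc hd)
    (hK.exists_interpolant_of_lattice hc hd hh fun a b hab ha hb => ?_)
  have := hmono hab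
  rw [ha, hb] at this
  exact absurd this (by decide)

theorem mem_of_lattice_of_not_monotone (hc : conj ∈ K 2) (hd : disj ∈ K 2) {m : ℕ}
    {f : BoolFun m} (hf : f ∈ K m) (hmono : ¬ Monotone f) {h : BoolFun n}
    (hh : h.IsIdempotent) : h ∈ K n := by
  obtain ⟨p, hp, p1, p2⟩ := hK.exists_ternary_of_not_monotone hf hmono
  refine hK.mem_of_interpolation (hK.maj_mem_of_lattice hc hd)
    (hK.exists_interpolant_of_lattice hc hd hh fun a b hab ha hb => ?_)
  -- the columns `00`, `01`, `11` all occur among the pairs `(a i, b i)`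
  obtain ⟨i, hi⟩ := hh.exists_apply_eq ha
  obtain ⟨j, hj⟩ := hh.exists_apply_eq hb
  have hne : ∃ k, a k = false ∧ b k = true := by
    by_contra! hne
    have : a = b := funext fun k => by
      have h1 := hne k
      have h2 := hab k
      revert h1 h2; cases a k <;> cases b k <;> simp
    rw [this, hb] at ha
    cases ha
  obtain ⟨k, hk1, hk2⟩ := hne
  have hi' : b i = true := by have := hab i; revert this; rw [hi]; cases b i <;> simp
  have hj' : a j = false := by have := hab j; revert this; rw [hj]; cases a j <;> simp
  exact ⟨_, hK.comp₃ hp (hK.proj_mem n j) (hK.proj_mem n k) (hK.proj_mem n i),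
    by simp only [hj', hk1, hi, p1], by simp only [hj, hk2, hi', p2]⟩

/-- A monotone self-dual function is interpolated at any two points by projections. -/
theorem mem_of_maj_of_monotone (hm : maj ∈ K 3) {h : BoolFun n} (hh : h.IsSelfDual)
    (hmono : Monotone h) : h ∈ K n := by
  refine hK.mem_of_interpolation hm fun a b => ?_
  have dec : ∀ a b, h a = true → h b = false → ∃ i, a i = true ∧ b i = false := by
    intro a b ha hb
    by_contra! hne
    have hab : a ≤ b := fun i => by
      have := hne i
      revert this; cases a i <;> cases b i <;> simp
    have := hmono hab
    rw [ha, hb] at this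
    exact absurd this (by decide)
  have neg : ∀ a c, h a = c → h (fun i => !a i) = !c := fun a c h' => by rw [hh, h']
  suffices ∃ i, a i = h a ∧ b i = h b by
    obtain ⟨i, hi⟩ := this
    exact ⟨_, hK.proj_mem n i, hi⟩
  cases ha : h a <;> cases hb : h b
  · obtain ⟨i, h1, h2⟩ := dec _ b (neg a _ ha) hb
    exact ⟨i, by simpa using h1, h2⟩
  · obtain ⟨i, h1, h2⟩ := dec b a hb ha
    exact ⟨i, h2, h1⟩
  · exact dec a b ha hb
  · obtain ⟨i, h1, h2⟩ := dec a _ ha (neg b _ hb)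
    exact ⟨i, h1, by simpa using h2⟩

/-- A self-dual idempotent function is interpolated at any two points by sums of three variables:
with columns `(aᵢ, bᵢ)` read as points of the affine plane over the field with two elements, three
distinct columns span the plane, and otherwise the value is itself a column. -/
theorem mem_of_maj_of_sum3 (hm : maj ∈ K 3) (hs : sum3 ∈ K 3) {h : BoolFun n}
    (hi : h.IsIdempotent) (hh : h.IsSelfDual) : h ∈ K n := by
  refine hK.mem_of_interpolation hm fun a b => ?_
  by_cases hcol : ∃ i, a i = h a ∧ b i = h b
  · obtain ⟨i, hi⟩ := hcol
    exact ⟨_, hK.proj_mem n i, hi⟩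
  · push Not at hcol
    obtain ⟨i, hi1⟩ := hi.exists_apply_eq (rfl : h a = h a)
    obtain ⟨j, hj1⟩ := hi.exists_apply_eq (rfl : h b = h b)
    -- the column opposite to `(h a, h b)` occurs, as otherwise `b` is `a` or its negation
    have hk : ∃ k, a k ≠ h a ∧ b k ≠ h b := by
      by_contra! hne
      have hx : ∀ i, xor (a i) (b i) = !(xor (h a) (h b)) := fun i => by
        have h1 := hne i
        have h2 := hcol i
        revert h1 h2
        cases a i <;> cases b i <;> cases h a <;> cases h b <;> simp
      cases hxor : xor (h a) (h b)
      · have : b = fun i => !a i := funext fun i => by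
          have := hx i; rw [hxor] at this
          revert this; cases a i <;> cases b i <;> simp
        rw [this, hh] at hxor
        simp at hxor
      · have : b = a := funext fun i => by
          have := hx i; rw [hxor] at this
          revert this; cases a i <;> cases b i <;> simp
        rw [this] at hxor
        simp at hxor
    obtain ⟨k, hk1, hk2⟩ := hk
    have hi2 := hcol i hi1
    have hj2 : a j ≠ h a := fun h' => hcol j h' hj1
    refine ⟨_, hK.comp₃ hs (hK.proj_mem n i) (hK.proj_mem n j) (hK.proj_mem n k), ?_, ?_⟩
    · simp only [sum3, Matrix.cons_val_zero, Matrix.cons_val_one, Matrix.cons_val, hi1]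
      revert hj2 hk1; cases a j <;> cases a k <;> cases h a <;> simp
    · simp only [sum3, Matrix.cons_val_zero, Matrix.cons_val_one, Matrix.cons_val, hj1]
      revert hi2 hk2; cases b i <;> cases b k <;> cases h b <;> simp

end IsBoolClone

/-! ### Post classification of the idempotent clones closed under duality -/

namespace IsBoolClone

open PostClass

variable {K : BoolClass} {n : ℕ}

/-- If every binary member of `K` takes different values at `01` and `10`, then identifying the
variables of a member according to a two-colouring shows that all members are self-dual. -/
theorem isSelfDual_of_binary (hK : IsBoolClone K)
    (hbin : ∀ f ∈ K 2, f ![false, true] ≠ f ![true, false]) {f : BoolFun n} (hf : f ∈ K n) :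
    f.IsSelfDual := by
  intro x
  have := hbin _ (hK.minor hf fun i => if x i then 1 else 0)
  have h1 : (fun i => (![false, true] : Fin 2 → Bool) (if x i then 1 else 0)) = x :=
    funext fun i => by cases x i <;> rfl
  have h2 : (fun i => (![true, false] : Fin 2 → Bool) (if x i then 1 else 0)) =
      fun i => !x i := funext fun i => by cases x i <;> rfl
  simp only [h1, h2] at this
  revert this
  cases f x <;> cases f (fun i => !x i) <;> simp

theorem _root_.PostClass.maj_isIdempotent : maj.IsIdempotent := by
  intro c; cases c <;> rfl

theorem _root_.PostClass.sum3_isIdempotent : sum3.IsIdempotent := by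
  intro c; cases c <;> rfl

theorem _root_.PostClass.maj_isSelfDual : maj.IsSelfDual := by
  intro x
  simp only [maj]; cases x 0 <;> cases x 1 <;> cases x 2 <;> rfl

theorem _root_.PostClass.sum3_isSelfDual : sum3.IsSelfDual := by
  intro x
  simp only [sum3]; cases x 0 <;> cases x 1 <;> cases x 2 <;> rfl

/-- A ternary self-dual idempotent `p` with `p(100) = p(001) = 1` and `p(010) = 0` satisfies
`p(x, y, y) = x`, `p(x, x, z) = z` and `p(x, y, x) = x`, and composes to majority and to the
ternary sum. -/
theorem maj_sum3_mem_of_pixley (hK : IsBoolClone K) {p : BoolFun 3} (hp : p ∈ K 3)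
    (hi : p.IsIdempotent) (hs : p.IsSelfDual) (h0 : p ![true, false, false] = true)
    (h1 : p ![false, true, false] = false) (h2 : p ![false, false, true] = true) :
    maj ∈ K 3 ∧ sum3 ∈ K 3 := by
  have P : p = fun x => (x 0 && !x 1) || (!x 1 && x 2) || (x 0 && x 2) := by
    refine BoolFun.ext_unit_vectors hi hs (by intro c; cases c <;> rfl) ?_ h0 h1 h2
    intro x
    beta_reduce
    cases x 0 <;> cases x 1 <;> cases x 2 <;> rfl
  have x0 := hK.proj_mem 3 0
  have x1 := hK.proj_mem 3 1
  have x2 := hK.proj_mem 3 2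
  -- `maj = p(x, p(x, y, z), z)`
  have hm : maj ∈ K 3 := by
    convert hK.comp₃ hp x0 hp x2 using 1
    funext x
    simp only [P, maj, Matrix.cons_val_zero, Matrix.cons_val_one, Matrix.cons_val]
    cases x 0 <;> cases x 1 <;> cases x 2 <;> rfl
  refine ⟨hm, ?_⟩
  -- `x ⊕ y ⊕ z = p(p(x, y, z), maj(x, y, z), p(y, x, z))`
  convert hK.comp₃ hp hp hm (hK.comp₃ hp x1 x0 x2) using 1
  funext x
  simp only [P, maj, sum3, Matrix.cons_val_zero, Matrix.cons_val_one, Matrix.cons_val]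
  cases x 0 <;> cases x 1 <;> cases x 2 <;> rfl

theorem sum3_mem_of_unit_vectors {f : BoolFun 3} (hf : f ∈ K 3) (hi : f.IsIdempotent)
    (hs : f.IsSelfDual) (h0 : f ![true, false, false] = true)
    (h1 : f ![false, true, false] = true) (h2 : f ![false, false, true] = true) :
    sum3 ∈ K 3 := by
  rwa [← BoolFun.ext_unit_vectors hi hs sum3_isIdempotent sum3_isSelfDual h0 h1 h2]

theorem sum3_mem_of_not_monotone (hK : IsBoolClone K)
    (hid : ∀ n, ∀ f ∈ K n, f.IsIdempotent) (hsd : ∀ n, ∀ f ∈ K n, f.IsSelfDual)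
    {f : BoolFun n} (hf : f ∈ K n) (hmono : ¬ Monotone f) : sum3 ∈ K 3 := by
  obtain ⟨p, hp, p1, p2⟩ := hK.exists_ternary_of_not_monotone hf hmono
  have p0 : p ![true, false, false] = true := by
    have := hsd 3 p hp ![false, true, true]
    rw [p2] at this
    refine (congrArg p (funext fun i => ?_)).trans this
    fin_cases i <;> rfl
  cases h : p ![false, true, false]
  · exact (hK.maj_sum3_mem_of_pixley hp (hid 3 p hp) (hsd 3 p hp) p0 h p1).2
  · exact sum3_mem_of_unit_vectors hp (hid 3 p hp) (hsd 3 p hp) p0 h p1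

/-- In a self-dual idempotent clone without majority, a ternary member takes the value `1` at an
odd number of unit vectors: it is a projection or the ternary sum. -/
theorem xor_unit_vectors (hK : IsBoolClone K)
    (hid : ∀ n, ∀ f ∈ K n, f.IsIdempotent) (hsd : ∀ n, ∀ f ∈ K n, f.IsSelfDual)
    (hm : maj ∉ K 3) {f : BoolFun 3} (hf : f ∈ K 3) :
    xor (xor (f ![true, false, false]) (f ![false, true, false])) (f ![false, false, true])
      = true := by
  by_contra hx
  refine hm ?_
  have x0 := hK.proj_mem 3 0
  have x1 := hK.proj_mem 3 1
  have x2 := hK.proj_mem 3 2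
  have pix : ∀ p ∈ K 3, p ![true, false, false] = true → p ![false, true, false] = false →
      p ![false, false, true] = true → maj ∈ K 3 := fun p hp h0 h1 h2 =>
    (hK.maj_sum3_mem_of_pixley hp (hid 3 p hp) (hsd 3 p hp) h0 h1 h2).1
  cases h0 : f ![true, false, false] <;> cases h1 : f ![false, true, false] <;>
    cases h2 : f ![false, false, true] <;> simp only [h0, h1, h2] at hx
  · rwa [← BoolFun.ext_unit_vectors (hid 3 f hf) (hsd 3 f hf) maj_isIdempotent maj_isSelfDual
      h0 h1 h2]
  · exact absurd rfl hx
  · exact absurd rfl hx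
  · exact pix _ (hK.comp₃ hf x1 x0 x2) h1 h0 h2
  · exact absurd rfl hx
  · exact pix f hf h0 h1 h2
  · exact pix _ (hK.comp₃ hf x0 x2 x1) h0 h2 h1
  · exact absurd rfl hx

/-- The sum modulo `2` of the variables with index in `S`. -/
def _root_.BoolFun.parity (S : Finset (Fin n)) : BoolFun n :=
  fun x => decide (Odd (S.filter fun i => x i = true).card)

open BoolFun in
theorem _root_.BoolFun.parity_insert {S : Finset (Fin n)} {i : Fin n} (hi : i ∉ S)
    (x : Fin n → Bool) : parity (insert i S) x = xor (x i) (parity S x) := by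
  unfold parity
  rw [Finset.filter_insert]
  cases h : x i
  · simp
  · rw [if_pos rfl, Finset.card_insert_of_notMem (by simp [hi])]
    simp [Nat.odd_add_one, -Nat.not_odd_iff_even]

open BoolFun in
theorem _root_.BoolFun.parity_singleton (i : Fin n) : parity {i} = fun x => x i := by
  funext x
  rw [← insert_empty_eq, parity_insert (by simp)]
  simp [parity]

open BoolFun in
/-- In a self-dual idempotent clone without majority, every member is a sum of an odd number of
variables: it is additive on disjoint sums of unit vectors by `xor_unit_vectors`. -/
theorem exists_eq_parity (hK : IsBoolClone K)
    (hid : ∀ n, ∀ f ∈ K n, f.IsIdempotent) (hsd : ∀ n, ∀ f ∈ K n, f.IsSelfDual)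
    (hm : maj ∉ K 3) {f : BoolFun n} (hf : f ∈ K n) :
    ∃ S : Finset (Fin n), Odd S.card ∧ f = parity S := by
  classical
  let ind : Finset (Fin n) → Fin n → Bool := fun U i => decide (i ∈ U)
  let S : Finset (Fin n) := {i | f (ind {i}) = true}
  have key : ∀ U : Finset (Fin n), f (ind U) = parity S (ind U) := by
    intro U
    induction U using Finset.induction_on with
    | empty =>
      have : ind ∅ = fun _ => false := by ext i; simp [ind]
      rw [this, hid n f hf]
      simp [parity]
    | insert j U hj ih =>
      -- the ternary minor collecting `j`, `U` and the rest
      have h3 := hK.xor_unit_vectors hid hsd hm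
        (hK.minor hf fun i => if i = j then 0 else if i ∈ U then 1 else 2)
      have e0 : (fun i => (![true, false, false] : Fin 3 → Bool)
          (if i = j then 0 else if i ∈ U then 1 else 2)) = ind {j} := by
        ext i; by_cases h : i = j <;> by_cases h' : i ∈ U <;> simp [ind, h, h']
      have e1 : (fun i => (![false, true, false] : Fin 3 → Bool)
          (if i = j then 0 else if i ∈ U then 1 else 2)) = ind U := by
        ext i; by_cases h : i = j
        · subst h; simp [ind, hj]
        · by_cases h' : i ∈ U <;> simp [ind, h, h']
      have e2 : (fun i => (![false, false, true] : Fin 3 → Bool)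
          (if i = j then 0 else if i ∈ U then 1 else 2)) = fun i => !ind (insert j U) i := by
        ext i; by_cases h : i = j <;> by_cases h' : i ∈ U <;> simp [ind, h, h']
      simp only [e0, e1, e2, hsd n f hf (ind (insert j U))] at h3
      have hadd : f (ind (insert j U)) = xor (f (ind {j})) (f (ind U)) := by
        revert h3
        cases f (ind {j}) <;> cases f (ind U) <;> cases f (ind (insert j U)) <;> simp
      rw [hadd, ih]
      unfold parity
      have hjmem : j ∈ S ↔ f (ind {j}) = true := by simp [S]
      by_cases hjS : f (ind {j}) = true
      · have : S.filter (fun i => ind (insert j U) i = true) =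
            insert j (S.filter fun i => ind U i = true) := by
          ext i
          by_cases h : i = j
          · subst h; simp [ind, hjmem.2 hjS]
          · simp [ind, h]
        rw [this, Finset.card_insert_of_notMem (by simp [ind, hj]), hjS]
        simp [Nat.odd_add_one, -Nat.not_odd_iff_even]
      · have : S.filter (fun i => ind (insert j U) i = true) =
            S.filter fun i => ind U i = true := by
          ext i
          by_cases h : i = j
          · subst h; simp [mt hjmem.1 hjS]
          · simp [ind, h]
        rw [this]
        simp [hjS]
  have hall : ∀ x, f x = parity S x := fun x => by
    have : x = ind (Finset.univ.filter fun i => x i = true) := by ext i; simp [ind]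
    rw [this]; exact key _
  refine ⟨S, ?_, funext hall⟩
  have h1 := hid n f hf true
  rw [hall] at h1
  simpa [parity] using h1

open BoolFun in
theorem parity_mem (hK : IsBoolClone K) (hs : sum3 ∈ K 3) (k : ℕ) :
    ∀ S : Finset (Fin n), S.card = 2 * k + 1 → parity S ∈ K n := by
  induction k with
  | zero =>
    intro S hS
    obtain ⟨i, rfl⟩ := Finset.card_eq_one.1 hS
    rw [parity_singleton]
    exact hK.proj_mem n i
  | succ k ih =>
    intro S hS
    obtain ⟨i, T, hi, rfl, hT⟩ := Finset.card_eq_succ.1 hS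
    obtain ⟨j, U, hj, rfl, hU⟩ := Finset.card_eq_succ.1 hT
    convert hK.comp₃ hs (hK.proj_mem n i) (hK.proj_mem n j) (ih U hU) using 1
    funext x
    rw [parity_insert hi, parity_insert hj]
    simp [sum3]

open BoolFun in
/-- A sum of at least three variables has the ternary sum as a minor: two summands are kept, and the
remaining ones, odd in number, are identified with each other. -/
theorem sum3_mem_of_parity (hK : IsBoolClone K) {S : Finset (Fin n)} (hS : Odd S.card)
    (h1 : S.card ≠ 1) (hf : parity S ∈ K n) : sum3 ∈ K 3 := by
  obtain ⟨k, hk⟩ := hS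
  obtain ⟨i, T, hi, rfl, hT⟩ := Finset.card_eq_succ.1 hk
  obtain ⟨k, rfl⟩ : ∃ l, k = l + 1 := ⟨k - 1, by omega⟩
  obtain ⟨j, U, hj, rfl, hU⟩ := Finset.card_eq_succ.1 hT
  have hne : i ≠ j := fun h => hi (h ▸ Finset.mem_insert_self _ _)
  have hiU : i ∉ U := fun h => hi (Finset.mem_insert_of_mem h)
  -- identify all variables except two of the summands
  have hmem := hK.minor hf fun l => if l = i then (0 : Fin 3) else if l = j then 1 else 2
  have hpar : ∀ y : Fin n → Bool, ∀ c, (∀ l ∈ U, y l = c) → parity U y = c := by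
    intro y c hy
    have : (U.filter fun l => y l = true) = if c then U else ∅ := by
      cases c
      · simpa [Finset.filter_eq_empty_iff] using hy
      · simpa [Finset.filter_eq_self] using hy
    unfold parity
    rw [this]
    cases c
    · simp
    · simp [hU]
  have hval : ∀ x : Fin 3 → Bool, parity (insert i (insert j U))
      (fun l => x (if l = i then 0 else if l = j then 1 else 2)) = sum3 x := by
    intro x
    rw [parity_insert hi, parity_insert hj, hpar _ (x 2)]
    · simp [sum3, hne.symm]
    · intro l hl
      rw [if_neg (ne_of_mem_of_not_mem hl hiU), if_neg (ne_of_mem_of_not_mem hl hj)]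
  rwa [← funext hval]

/-- **Post's classification** of the idempotent clones closed under duality, when some binary
member is a semilattice operation. -/
theorem eq_A4_or_C4 (hK : IsBoolClone K) (hid : ∀ n, ∀ f ∈ K n, f.IsIdempotent)
    (hdual : ∀ n, ∀ f ∈ K n, f.dual ∈ K n)
    (hbin : ∃ f ∈ K 2, f ![false, true] = f ![true, false]) : K = A4 ∨ K = C4 := by
  have hlat : conj ∈ K 2 ∧ disj ∈ K 2 := by
    obtain ⟨f, hf, h⟩ := hbin
    have vec : ∀ (x : Fin 2 → Bool), x = ![x 0, x 1] := fun x => by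
      ext i; fin_cases i <;> rfl
    have ext2 : ∀ g k : BoolFun 2, (∀ a b, g ![a, b] = k ![a, b]) → g = k := fun g k h' =>
      funext fun x => by rw [vec x]; exact h' _ _
    have hc : ∀ c, f ![c, c] = c := fun c => by
      rw [← hid 2 f hf c, hid 2 f hf c]
      exact (congrArg f (vec fun _ => c).symm).trans (hid 2 f hf c)
    have hd : ∀ a b, f.dual ![a, b] = !f ![!a, !b] := fun a b => by
      unfold BoolFun.dual
      congr 2
      exact vec _
    cases h1 : f ![false, true]
    · have : f = conj := ext2 _ _ fun a b => by
        cases a <;> cases b <;> simp [conj, hc, h1, ← h]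
      have h2 : f.dual = disj := ext2 _ _ fun a b => by
        rw [hd, this]; simp [conj, disj]
      exact ⟨this ▸ hf, h2 ▸ hdual 2 f hf⟩
    · have : f = disj := ext2 _ _ fun a b => by
        cases a <;> cases b <;> simp [disj, hc, h1, ← h]
      have h2 : f.dual = conj := ext2 _ _ fun a b => by
        rw [hd, this]; simp [conj, disj]
      exact ⟨h2 ▸ hdual 2 f hf, this ▸ hf⟩
  by_cases hmono : ∀ n, ∀ f ∈ K n, Monotone f
  · left
    funext n
    refine Set.Subset.antisymm (fun f hf => ?_) (hK.boolClone_subset (by simpa using hlat) n)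
    exact (isBoolClone_boolClone _).mem_of_lattice_of_monotone
      (.basic 2 _ (by simp)) (.basic 2 _ (by simp)) (hid n f hf) (hmono n f hf)
  · right
    push Not at hmono
    obtain ⟨m, g, hg, hgm⟩ := hmono
    funext n
    refine Set.Subset.antisymm (fun f hf => ⟨hid n f hf false, hid n f hf true⟩) fun f hf => ?_
    exact hK.mem_of_lattice_of_not_monotone hlat.1 hlat.2 hg hgm
      (fun c => by cases c; exacts [hf.1, hf.2])

/-- **Post's classification** of the idempotent clones all of whose binary members are
projections. -/
theorem eq_O1_or_D1_or_D2_or_L4 (hK : IsBoolClone K) (hid : ∀ n, ∀ f ∈ K n, f.IsIdempotent)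
    (hbin : ∀ f ∈ K 2, f ![false, true] ≠ f ![true, false]) :
    K = O1 ∨ K = D1 ∨ K = D2 ∨ K = L4 := by
  have hsd : ∀ n, ∀ f ∈ K n, f.IsSelfDual := fun n f hf => hK.isSelfDual_of_binary hbin hf
  by_cases hm : maj ∈ K 3
  · by_cases hmono : ∀ n, ∀ f ∈ K n, Monotone f
    · right; right; left
      funext n
      refine Set.Subset.antisymm (fun f hf => ?_) (hK.boolClone_subset (by simpa using hm) n)
      exact (isBoolClone_boolClone _).mem_of_maj_of_monotone (.basic 3 _ (by simp))
        (hsd n f hf) (hmono n f hf)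
    · right; left
      push Not at hmono
      obtain ⟨m, g, hg, hgm⟩ := hmono
      have hs := hK.sum3_mem_of_not_monotone hid hsd hg hgm
      funext n
      refine Set.Subset.antisymm (fun f hf => ?_)
        (hK.boolClone_subset (by simpa using ⟨hm, hs⟩) n)
      exact (isBoolClone_boolClone _).mem_of_maj_of_sum3 (.basic 3 _ (by simp))
        (.basic 3 _ (by simp)) (hid n f hf) (hsd n f hf)
  · by_cases hs : sum3 ∈ K 3
    · right; right; right
      funext n
      refine Set.Subset.antisymm (fun f hf => ?_) (hK.boolClone_subset (by simpa using hs) n)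
      obtain ⟨S, ⟨k, hk⟩, rfl⟩ := hK.exists_eq_parity hid hsd hm hf
      exact (isBoolClone_boolClone _).parity_mem (.basic 3 _ (by simp)) k S hk
    · left
      funext n
      refine Set.Subset.antisymm (fun f hf => ?_)
        (hK.boolClone_subset (by rintro _ rfl; exact hK.proj_mem 1 0) n)
      obtain ⟨S, hS, rfl⟩ := hK.exists_eq_parity hid hsd hm hf
      have h1 : S.card = 1 := by
        by_contra h1
        exact hs (hK.sum3_mem_of_parity hS h1 hf)
      obtain ⟨i, rfl⟩ := Finset.card_eq_one.1 h1
      rw [BoolFun.parity_singleton]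
      exact .proj n i

end IsBoolClone

/-! ### Conservative binary operations -/

/-- A set of conservative binary operations on `A` that contains both projections and is closed
under composition and under conjugation by permutations of `A`. -/
structure IsSymmBinaryClone {A : Type*} (B : Set (A → A → A)) : Prop where
  fst_mem : (fun a _ => a) ∈ B
  snd_mem : (fun _ b => b) ∈ B
  comp_mem : ∀ f ∈ B, ∀ g ∈ B, ∀ h ∈ B, (fun a b => f (g a b) (h a b)) ∈ B
  conservative : ∀ f ∈ B, ∀ a b, f a b = a ∨ f a b = b
  conj_mem : ∀ f ∈ B, ∀ σ : Equiv.Perm A, (fun a b => σ.symm (f (σ a) (σ b))) ∈ B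

namespace IsSymmBinaryClone

variable {A : Type*} {B : Set (A → A → A)}

/-- The symmetric group is `k`-transitive for every `k`. -/
theorem exists_perm {k : ℕ} {x y : Fin k → A} (hx : Function.Injective x)
    (hy : Function.Injective y) : ∃ σ : Equiv.Perm A, ∀ i, σ (x i) = y i := by
  have := Equiv.Perm.isMultiplyPretransitive A k
  obtain ⟨σ, hσ⟩ := MulAction.exists_smul_eq (Equiv.Perm A) (⟨x, hx⟩ : Fin k ↪ A) ⟨y, hy⟩
  exact ⟨σ, fun i => DFunLike.congr_fun hσ i⟩

theorem exists_perm₂ {a b c d : A} (hab : a ≠ b) (hcd : c ≠ d) :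
    ∃ σ : Equiv.Perm A, σ a = c ∧ σ b = d := by
  obtain ⟨σ, h⟩ := exists_perm (x := ![a, b]) (y := ![c, d])
    (by simp [Function.Injective, Fin.forall_fin_two, hab, hab.symm])
    (by simp [Function.Injective, Fin.forall_fin_two, hcd, hcd.symm])
  exact ⟨σ, h 0, h 1⟩

theorem injective_vec₃ {a b c : A} (hab : a ≠ b) (hac : a ≠ c) (hbc : b ≠ c) :
    Function.Injective ![a, b, c] := by
  intro i j
  fin_cases i <;> fin_cases j <;> simp [hab, hac, hbc, hab.symm, hac.symm, hbc.symm]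

theorem exists_perm₃ {a b c a' b' c' : A} (hab : a ≠ b) (hac : a ≠ c) (hbc : b ≠ c)
    (hab' : a' ≠ b') (hac' : a' ≠ c') (hbc' : b' ≠ c') :
    ∃ σ : Equiv.Perm A, σ a = a' ∧ σ b = b' ∧ σ c = c' := by
  obtain ⟨σ, h⟩ := exists_perm (injective_vec₃ hab hac hbc) (injective_vec₃ hab' hac' hbc')
  exact ⟨σ, h 0, h 1, h 2⟩

theorem injective_vec₄ {a b c d : A} (hab : a ≠ b) (hac : a ≠ c) (had : a ≠ d) (hbc : b ≠ c)
    (hbd : b ≠ d) (hcd : c ≠ d) : Function.Injective ![a, b, c, d] := by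
  intro i j
  fin_cases i <;> fin_cases j <;>
    simp [hab, hac, had, hbc, hbd, hcd, hab.symm, hac.symm, had.symm, hbc.symm, hbd.symm, hcd.symm]

theorem exists_perm₄ {a b c d a' b' c' d' : A} (hab : a ≠ b) (hac : a ≠ c) (had : a ≠ d)
    (hbc : b ≠ c) (hbd : b ≠ d) (hcd : c ≠ d) (hab' : a' ≠ b') (hac' : a' ≠ c') (had' : a' ≠ d')
    (hbc' : b' ≠ c') (hbd' : b' ≠ d') (hcd' : c' ≠ d') :
    ∃ σ : Equiv.Perm A, σ a = a' ∧ σ b = b' ∧ σ c = c' ∧ σ d = d' := by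
  obtain ⟨σ, h⟩ := exists_perm (injective_vec₄ hab hac had hbc hbd hcd)
    (injective_vec₄ hab' hac' had' hbc' hbd' hcd')
  exact ⟨σ, h 0, h 1, h 2, h 3⟩

variable (hB : IsSymmBinaryClone B)
include hB

theorem idem {f : A → A → A} (hf : f ∈ B) (a : A) : f a a = a :=
  (hB.conservative f hf a a).elim id id

theorem swap_mem {f : A → A → A} (hf : f ∈ B) : (fun a b => f b a) ∈ B :=
  hB.comp_mem f hf _ hB.snd_mem _ hB.fst_mem

/-! ### Some operation is commutative on some pair -/

/-- If some operation in `B` is commutative on one pair, then some operation in `B` is commutative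
on all pairs. -/
theorem exists_commutative [Finite A] (h : ∃ f ∈ B, ∃ a b, a ≠ b ∧ f a b = f b a) :
    ∃ t ∈ B, ∀ a b, t a b = t b a := by
  classical
  obtain ⟨f, hf, a₀, b₀, hne, hcom⟩ := h
  have := Fintype.ofFinite A
  suffices H : ∀ S : Finset (A × A), ∃ t ∈ B, ∀ p ∈ S, t p.1 p.2 = t p.2 p.1 by
    obtain ⟨t, ht, H⟩ := H Finset.univ
    exact ⟨t, ht, fun a b => H (a, b) (Finset.mem_univ _)⟩
  intro S
  induction S using Finset.induction_on with
  | empty => exact ⟨f, hf, by simp⟩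
  | insert p S _ ih =>
    obtain ⟨t, ht, hS⟩ := ih
    obtain ⟨a, b⟩ := p
    by_cases hab : a = b
    · refine ⟨t, ht, fun p hp => ?_⟩
      rcases Finset.mem_insert.1 hp with rfl | hp
      · simp [hab]
      · exact hS p hp
    · obtain ⟨σ, ha, hb⟩ := exists_perm₂ hab hne
      -- `g(t(x, y), t(y, x))` is commutative where `t` or `g` is
      set g : A → A → A := fun x y => σ.symm (f (σ x) (σ y)) with hg
      have hgB : g ∈ B := hB.conj_mem f hf σ
      have hgab : g a b = g b a := by simp only [hg, ha, hb, hcom]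
      refine ⟨_, hB.comp_mem g hgB t ht _ (hB.swap_mem ht), fun p hp => ?_⟩
      rcases Finset.mem_insert.1 hp with rfl | hp
      · rcases hB.conservative t ht a b with h1 | h1 <;>
          rcases hB.conservative t ht b a with h2 | h2 <;> simp [h1, h2, hgab]
      · simp only [hS p hp]

/-- A tournament on at least four vertices realizes all four orientations of a path with two
edges. -/
theorem exists_path_of_commutative [Finite A] (hA : 4 ≤ Nat.card A) {t : A → A → A}
    (ht : t ∈ B) (hcom : ∀ a b, t a b = t b a) (u v : Bool) :
    ∃ x y z, x ≠ y ∧ x ≠ z ∧ y ≠ z ∧ t x y = (cond u x y) ∧ t x z = (cond v x z) := by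
  have := Fintype.ofFinite A
  have hcard : Fintype.card (Fin 4) ≤ Fintype.card A := by
    rwa [Fintype.card_fin, ← Nat.card_eq_fintype_card]
  obtain ⟨e⟩ := Function.Embedding.nonempty_of_card_le hcard
  have h01 : e 0 ≠ e 1 := e.injective.ne (by decide)
  have h02 : e 0 ≠ e 2 := e.injective.ne (by decide)
  have h03 : e 0 ≠ e 3 := e.injective.ne (by decide)
  have h12 : e 1 ≠ e 2 := e.injective.ne (by decide)
  have h13 : e 1 ≠ e 3 := e.injective.ne (by decide)
  have h23 : e 2 ≠ e 3 := e.injective.ne (by decide)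
  by_contra! H
  have key : ∀ x y z, x ≠ y → x ≠ z → y ≠ z → t x y = cond u x y → t x z ≠ cond v x z := H
  have c := hB.conservative t ht
  have c01 := c (e 0) (e 1)
  have c02 := c (e 0) (e 2)
  have c03 := c (e 0) (e 3)
  have c12 := c (e 1) (e 2)
  have c13 := c (e 1) (e 3)
  have c23 := c (e 2) (e 3)
  clear H
  cases u <;> cases v <;> simp only [cond_true, cond_false] at key <;> grind

/-- If some operation in `B` is commutative on some pair, then every choice of values on two
distinct pairs is realized by some commutative operation in `B`. -/
theorem exists_commutative_with_values [Finite A] (hA : 4 ≤ Nat.card A)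
    (h : ∃ f ∈ B, ∃ a b, a ≠ b ∧ f a b = f b a) {p q r s : A} (hpq : p ≠ q) (hrs : r ≠ s)
    (hne : ({p, q} : Set A) ≠ {r, s}) (u v : Bool) :
    ∃ t ∈ B, (∀ a b, t a b = t b a) ∧ t p q = cond u p q ∧ t r s = cond v r s := by
  obtain ⟨t, ht, hcom⟩ := hB.exists_commutative h
  have c := hB.conservative t ht
  have conjCom : ∀ σ : Equiv.Perm A, ∀ a b,
      σ.symm (t (σ a) (σ b)) = σ.symm (t (σ b) (σ a)) := fun σ a b => by rw [hcom]
  -- two pairs with a common point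
  have share : ∀ (a b d : A), a ≠ b → a ≠ d → b ≠ d → ∀ u v : Bool, ∃ t ∈ B,
      (∀ a b, t a b = t b a) ∧ t a b = cond u a b ∧ t a d = cond v a d := by
    intro a b d hab had hbd u v
    obtain ⟨x, y, z, hxy, hxz, hyz, h1, h2⟩ := hB.exists_path_of_commutative hA ht hcom u v
    obtain ⟨σ, ha, hb, hd⟩ := exists_perm₃ hab had hbd hxy hxz hyz
    refine ⟨_, hB.conj_mem t ht σ, conjCom σ, ?_, ?_⟩
    · simp only [ha, hb, h1, Equiv.symm_apply_eq]; cases u <;> simp [ha, hb]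
    · simp only [ha, hd, h2, Equiv.symm_apply_eq]; cases v <;> simp [ha, hd]
  by_cases hpr : p = r
  · subst hpr
    exact share p q s hpq hrs (fun h => hne (by rw [h])) u v
  by_cases hps : p = s
  · subst hps
    obtain ⟨t, ht, hc, h1, h2⟩ := share p q r hpq hrs.symm
      (fun h => hne (by rw [h, Set.pair_comm])) u (!v)
    exact ⟨t, ht, hc, h1, by rw [hc, h2]; cases v <;> rfl⟩
  by_cases hqr : q = r
  · subst hqr
    obtain ⟨t, ht, hc, h1, h2⟩ := share q p s hpq.symm hrs hps (!u) v
    exact ⟨t, ht, hc, by rw [hc, h1]; cases u <;> rfl, h2⟩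
  by_cases hqs : q = s
  · subst hqs
    obtain ⟨t, ht, hc, h1, h2⟩ := share q p r hpq.symm hrs.symm hpr (!u) (!v)
    exact ⟨t, ht, hc, by rw [hc, h1]; cases u <;> rfl, by rw [hc, h2]; cases v <;> rfl⟩
  -- disjoint pairs: permute each of them separately
  have main : ∀ p' q' r' s' : A, p' ≠ q' → p' ≠ r' → p' ≠ s' → q' ≠ r' → q' ≠ s' → r' ≠ s' →
      t p' q' = cond u p' q' → t r' s' = cond v r' s' →
      ∃ t ∈ B, (∀ a b, t a b = t b a) ∧ t p q = cond u p q ∧ t r s = cond v r s := by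
    intro p' q' r' s' n1 n2 n3 n4 n5 n6 e1 e2
    obtain ⟨σ, h1, h2, h3, h4⟩ := exists_perm₄ hpq hpr hps hqr hqs hrs n1 n2 n3 n4 n5 n6
    refine ⟨_, hB.conj_mem t ht σ, conjCom σ, ?_, ?_⟩
    · simp only [h1, h2, e1, Equiv.symm_apply_eq]; cases u <;> simp [h1, h2]
    · simp only [h3, h4, e2, Equiv.symm_apply_eq]; cases v <;> simp [h3, h4]
  have orient : ∀ a b, ∀ w : Bool, t a b = cond w a b ∨ t b a = cond w b a := by
    intro a b w
    rcases c a b with h | h <;> cases w <;> simp [h, hcom b a]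
  rcases orient p q u with e1 | e1 <;> rcases orient r s v with e2 | e2
  · exact main p q r s hpq hpr hps hqr hqs hrs e1 e2
  · exact main p q s r hpq hps hpr hqs hqr (Ne.symm hrs) e1 e2
  · exact main q p r s (Ne.symm hpq) hqr hqs hpr hps hrs e1 e2
  · exact main q p s r (Ne.symm hpq) hqs hqr hps hpr (Ne.symm hrs) e1 e2

/-- If some operation in `B` is commutative on some pair, then any two distinct pairs are separated
by an operation in `B`: with the four combinations of lattice operations on the two pairs,
absorption yields `x` on the first pair and `y` on the second. -/
theorem exists_separating_of_commutative [Finite A] (hA : 4 ≤ Nat.card A)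
    (h : ∃ f ∈ B, ∃ a b, a ≠ b ∧ f a b = f b a) {p q r s : A} (hpq : p ≠ q) (hrs : r ≠ s)
    (hne : ({p, q} : Set A) ≠ {r, s}) :
    ∃ f ∈ B, f p q = p ∧ f q p = q ∧ f r s = s ∧ f s r = r := by
  obtain ⟨m, hm, cm, m1, m2⟩ := hB.exists_commutative_with_values hA h hpq hrs hne true true
  obtain ⟨j, hj, cj, j1, j2⟩ := hB.exists_commutative_with_values hA h hpq hrs hne false false
  obtain ⟨k, hk, ck, k1, k2⟩ := hB.exists_commutative_with_values hA h hpq hrs hne true false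
  obtain ⟨l, hl, cl, l1, l2⟩ := hB.exists_commutative_with_values hA h hpq hrs hne false true
  simp only [cond_true, cond_false] at *
  have f1 := hB.comp_mem m hm _ hB.fst_mem l hl
  have f2 := hB.comp_mem j hj _ hB.fst_mem k hk
  have f3 := hB.comp_mem _ f1 _ f2 _ hB.snd_mem
  refine ⟨_, f3, ?_⟩
  have im := hB.idem hm
  have ij := hB.idem hj
  have il := hB.idem hl
  simp [k1, k2, l1, l2, m1, m2, j1, j2, cm s r, cj q p, ck q p, ck s r,
    cl q p, cl s r, im, ij, il]

/-! ### Every operation is a projection on every pair -/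

/-- If every operation in `B` acts on each pair as a projection and some operation in `B` is not a
projection, then any two distinct pairs are separated by an operation in `B`. Inseparability is an
equivalence relation between pairs that is invariant under permutations; on at least five points
such a relation is trivial. -/
theorem exists_separating_of_noncommutative [Finite A] (hA : 5 ≤ Nat.card A)
    (h : ∀ f ∈ B, ∀ a b, a ≠ b → f a b ≠ f b a)
    (hproj : ∃ f ∈ B, f ≠ (fun a _ => a) ∧ f ≠ (fun _ b => b)) {p q r s : A} (hpq : p ≠ q)
    (hrs : r ≠ s) (hne : ({p, q} : Set A) ≠ {r, s}) :
    ∃ f ∈ B, f p q = p ∧ f q p = q ∧ f r s = s ∧ f s r = r := by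
  have val : ∀ f ∈ B, ∀ a b, a ≠ b → (f a b = a ∧ f b a = b) ∨ (f a b = b ∧ f b a = a) := by
    intro f hf a b hab
    have h1 := hB.conservative f hf a b
    have h2 := hB.conservative f hf b a
    have h3 := h f hf a b hab
    grind
  let I : A → A → A → A → Prop := fun a b c d => ∀ f ∈ B, f a b = a ↔ f c d = c
  have conjI : ∀ a b c d, I a b c d → ∀ σ : Equiv.Perm A, I (σ a) (σ b) (σ c) (σ d) := by
    intro a b c d hI σ f hf
    have := hI _ (hB.conj_mem f hf σ)
    simpa only [Equiv.symm_apply_eq] using this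
  have swapI : ∀ a b, a ≠ b → I a b b a := by
    intro a b hab f hf
    have := val f hf a b hab
    grind
  have transI : ∀ a b c d e g, I a b c d → I c d e g → I a b e g :=
    fun a b c d e g h1 h2 f hf => (h1 f hf).trans (h2 f hf)
  have symmI : ∀ a b c d, I a b c d → I c d a b := fun a b c d h1 f hf => (h1 f hf).symm
  by_cases hI : I p q r s
  · exfalso
    -- two inseparable pairs with a common point
    have share : ∃ a b d, a ≠ b ∧ a ≠ d ∧ b ≠ d ∧ I a b a d := by
      by_cases hpr : p = r
      · subst hpr
        exact ⟨p, q, s, hpq, hrs, fun h => hne (by rw [h]), hI⟩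
      by_cases hps : p = s
      · subst hps
        exact ⟨p, q, r, hpq, hrs.symm, fun h => hne (by rw [h, Set.pair_comm]),
          transI _ _ _ _ _ _ hI (swapI _ _ hrs)⟩
      by_cases hqr : q = r
      · subst hqr
        exact ⟨q, p, s, hpq.symm, hrs, hps, transI _ _ _ _ _ _ (swapI _ _ hpq.symm) hI⟩
      by_cases hqs : q = s
      · subst hqs
        exact ⟨q, p, r, hpq.symm, hrs.symm, hpr, transI _ _ _ _ _ _ (swapI _ _ hpq.symm)
          (transI _ _ _ _ _ _ hI (swapI _ _ hrs))⟩
      -- a fifth point yields a second pair inseparable from `p`, `q`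
      obtain ⟨z, hz⟩ : ∃ z, z ∉ ({p, q, r, s} : Set A) := by
        by_contra! hall
        have h1 : Nat.card A ≤ 4 := by
          rw [← Set.ncard_univ, ← Set.eq_univ_of_forall hall]
          refine (Set.ncard_insert_le _ _).trans (Nat.succ_le_succ ?_)
          refine (Set.ncard_insert_le _ _).trans (Nat.succ_le_succ ?_)
          exact (Set.ncard_insert_le _ _).trans (Nat.succ_le_succ (Set.ncard_singleton _).le)
        omega
      simp only [Set.mem_insert_iff, Set.mem_singleton_iff, not_or] at hz
      obtain ⟨zp, zq, zr, zs⟩ := hz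
      obtain ⟨σ, h1, h2, h3, h4⟩ := exists_perm₄ hpq hpr hps hqr hqs hrs hpq hpr (Ne.symm zp) hqr
        (Ne.symm zq) (Ne.symm zr)
      have := conjI _ _ _ _ hI σ
      rw [h1, h2, h3, h4] at this
      exact ⟨r, s, z, hrs, Ne.symm zr, Ne.symm zs, transI _ _ _ _ _ _ (symmI _ _ _ _ hI) this⟩
    obtain ⟨a₀, b₀, d₀, n1, n2, n3, h0⟩ := share
    have star : ∀ a b d, a ≠ b → a ≠ d → I a b a d := by
      intro a b d hab had
      by_cases hbd : b = d
      · subst hbd; exact fun f _ => Iff.rfl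
      obtain ⟨σ, h1, h2, h3⟩ := exists_perm₃ n1 n2 n3 hab had hbd
      have := conjI _ _ _ _ h0 σ
      rwa [h1, h2, h3] at this
    have all : ∀ a b c d, a ≠ b → c ≠ d → I a b c d := by
      intro a b c d hab hcd
      by_cases had : a = d
      · subst had
        exact transI _ _ _ _ _ _ (star a b c hab hcd.symm) (swapI _ _ hcd.symm)
      · exact transI _ _ _ _ _ _ (star a b d hab had) (transI _ _ _ _ _ _ (swapI _ _ had)
          (transI _ _ _ _ _ _ (star d a c (Ne.symm had) hcd.symm) (swapI _ _ hcd.symm)))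
    obtain ⟨f, hf, f1, f2⟩ := hproj
    by_cases hpq' : f p q = p
    · refine f1 (funext fun a => funext fun b => ?_)
      by_cases hab : a = b
      · subst hab; exact hB.idem hf a
      · exact (all p q a b hpq hab f hf).1 hpq'
    · refine f2 (funext fun a => funext fun b => ?_)
      by_cases hab : a = b
      · subst hab; exact hB.idem hf a
      · exact (hB.conservative f hf a b).resolve_left
          fun h => hpq' ((all p q a b hpq hab f hf).2 h)
  · simp only [I, not_forall] at hI
    obtain ⟨f, hf, hI⟩ := hI
    have v1 := val f hf p q hpq
    have v2 := val f hf r s hrs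
    by_cases hp : f p q = p
    · refine ⟨f, hf, ?_⟩
      grind
    · refine ⟨_, hB.swap_mem hf, ?_⟩
      grind

theorem exists_separating [Finite A] (hA : 5 ≤ Nat.card A)
    (hproj : ∃ f ∈ B, f ≠ (fun a _ => a) ∧ f ≠ (fun _ b => b)) {p q r s : A} (hpq : p ≠ q)
    (hrs : r ≠ s) (hne : ({p, q} : Set A) ≠ {r, s}) :
    ∃ f ∈ B, f p q = p ∧ f q p = q ∧ f r s = s ∧ f s r = r := by
  by_cases h : ∃ f ∈ B, ∃ a b, a ≠ b ∧ f a b = f b a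
  · exact hB.exists_separating_of_commutative (by omega) h hpq hrs hne
  · push Not at h
    exact hB.exists_separating_of_noncommutative hA h hproj hpq hrs hne

/-- Separating a pair from all the others one at a time gives an operation in `B` that is the first
projection on exactly this pair and the second projection on all the others. -/
theorem exists_isolating [Finite A] (hA : 5 ≤ Nat.card A)
    (hproj : ∃ f ∈ B, f ≠ (fun a _ => a) ∧ f ≠ (fun _ b => b)) {p q : A} (hpq : p ≠ q) :
    ∃ f ∈ B, f p q = p ∧ f q p = q ∧ ∀ r s, ({p, q} : Set A) ≠ {r, s} → f r s = s := by
  classical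
  have := Fintype.ofFinite A
  suffices H : ∀ S : Finset (A × A), ∃ f ∈ B, f p q = p ∧ f q p = q ∧
      ∀ u ∈ S, ({p, q} : Set A) ≠ {u.1, u.2} → f u.1 u.2 = u.2 by
    obtain ⟨f, hf, h1, h2, H⟩ := H Finset.univ
    exact ⟨f, hf, h1, h2, fun r s => H (r, s) (Finset.mem_univ _)⟩
  intro S
  induction S using Finset.induction_on with
  | empty => exact ⟨_, hB.fst_mem, rfl, rfl, by simp⟩
  | insert u S _ ih =>
    obtain ⟨t, ht, h1, h2, hS⟩ := ih
    obtain ⟨r, s⟩ := u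
    by_cases hu : ({p, q} : Set A) ≠ {r, s} ∧ r ≠ s
    · obtain ⟨f, hf, f1, f2, f3, -⟩ := hB.exists_separating hA hproj hpq hu.2 hu.1
      refine ⟨_, hB.comp_mem f hf t ht _ hB.snd_mem, by simp only [h1, f1], by simp only [h2, f2],
        fun v hv hne => ?_⟩
      rcases Finset.mem_insert.1 hv with rfl | hv
      · rcases hB.conservative t ht r s with h | h <;> simp only [h, f3, hB.idem hf]
      · simp only [hS v hv hne, hB.idem hf]
    · refine ⟨t, ht, h1, h2, fun v hv hne => ?_⟩
      rcases Finset.mem_insert.1 hv with rfl | hv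
      · have hrs : r = s := by
          by_contra h
          exact hu ⟨hne, h⟩
        subst hrs
        exact hB.idem ht r
      · exact hS v hv hne

end IsSymmBinaryClone

/-! ### Tuples and the action of a function on a pair -/

namespace TwoTuple

variable {A : Type*} {n : ℕ}

/-- The tuple `(e x₁, …, e xₙ)`. -/
def ofBool (e : Bool → A) (x : Fin n → Bool) : TwoTuple A n :=
  ⟨fun i => e (x i), by
    refine (Set.ncard_le_ncard (t := e '' Set.univ) ?_ (Set.toFinite _)).trans ?_
    · rintro _ ⟨i, rfl⟩; exact ⟨_, trivial, rfl⟩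
    · refine (Set.ncard_image_le (Set.toFinite _)).trans ?_
      simp⟩

/-- The pair `(a, b)`. -/
def pair (a b : A) : TwoTuple A 2 :=
  ⟨![a, b], by
    have : Set.range ![a, b] = {b, a} := by simp [Matrix.range_cons, Matrix.range_empty]
    rw [this]
    exact (Set.ncard_insert_le _ _).trans (by simp)⟩

theorem eq_pair (x : TwoTuple A 2) : x = pair (x.1 0) (x.1 1) := by
  apply Subtype.ext
  ext i; fin_cases i <;> rfl

/-- Every tuple has its entries in some two-element set, even if it is constant or empty. -/
theorem exists_eq_ofBool [Finite A] (hA : 2 ≤ Nat.card A) (x : TwoTuple A n) :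
    ∃ e : Bool → A, Function.Injective e ∧ ∃ y, x = ofBool e y := by
  obtain ⟨b, hb, -, hb2⟩ := Set.exists_subsuperset_card_eq (Set.subset_univ (Set.range x.1)) x.2
    (by rwa [Set.ncard_univ])
  obtain ⟨p, q, hpq, rfl⟩ := Set.ncard_eq_two.1 hb2
  classical
  refine ⟨fun t => cond t q p, ?_, fun i => decide (x.1 i = q), ?_⟩
  · intro s t
    cases s <;> cases t <;> simp [hpq, hpq.symm]
  · apply Subtype.ext
    funext i
    have : x.1 i = p ∨ x.1 i = q := by simpa using hb ⟨i, rfl⟩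
    by_cases h : x.1 i = q
    · simp [ofBool, h]
    · simp only [ofBool, h, decide_false, cond_false]
      exact this.resolve_right h

end TwoTuple

namespace TwoFun

variable {A : Type*} {n : ℕ}

open scoped Classical in
/-- The Boolean function by which `g` acts on the pair `{e 0, e 1}`; it describes this action when
`g` is conservative and `e` is injective. -/
noncomputable def restrict (e : Bool → A) (g : TwoFun A n) : BoolFun n :=
  fun x => decide (g (TwoTuple.ofBool e x) = e true)

theorem IsConservative.apply_ofBool {g : TwoFun A n} (hg : g.IsConservative) (e : Bool → A)
    (x : Fin n → Bool) : g (TwoTuple.ofBool e x) = e (g.restrict e x) := by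
  unfold restrict
  by_cases h : g (TwoTuple.ofBool e x) = e true
  · simp [h]
  · obtain ⟨i, hi⟩ := hg (TwoTuple.ofBool e x)
    simp only [h, decide_false]
    rw [hi] at h ⊢
    simp only [TwoTuple.ofBool] at h ⊢
    cases hx : x i
    · rfl
    · simp [hx] at h

theorem restrict_eq {e : Bool → A} (he : Function.Injective e) {g : TwoFun A n} {h : BoolFun n}
    (H : ∀ x, g (TwoTuple.ofBool e x) = e (h x)) : g.restrict e = h := by
  funext x
  unfold restrict
  rw [H, ← Bool.coe_iff_coe]
  simp [he.eq_iff]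

/-- Acting on a two-element set as `h` means restricting to `h` along the inverse of the
identification with `{0, 1}`. -/
theorem actsAs_iff {b : Set A} {σ : b ≃ Bool} {g : TwoFun A n} {h : BoolFun n} :
    g.ActsAs b σ h ↔ ∀ x, g (TwoTuple.ofBool (fun t => (σ.symm t : A)) x) = σ.symm (h x) := by
  constructor
  · intro H x
    rw [H _ (fun i => (σ.symm (x i)).2)]
    simp [TwoTuple.ofBool]
  · intro H x hx
    rw [← H]
    congr 1
    apply Subtype.ext
    funext i
    simp [TwoTuple.ofBool]

theorem injective_symm {b : Set A} (σ : b ≃ Bool) :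
    Function.Injective fun t => (σ.symm t : A) :=
  Subtype.val_injective.comp σ.symm.injective

/-- Every injection of `{0, 1}` into `A` is the inverse of an identification of its range with
`{0, 1}`. -/
theorem exists_equiv {e : Bool → A} (he : Function.Injective e) :
    ∃ b : Set A, b.ncard = 2 ∧ ∃ σ : b ≃ Bool, (fun t => (σ.symm t : A)) = e :=
  ⟨Set.range e, by rw [Set.ncard_range_of_injective he]; simp,
    (Equiv.ofInjective e he).symm, rfl⟩

/-- A function associated with idempotent Boolean functions is conservative. -/
theorem isConservative_of_restrict [Finite A] (hA : 2 ≤ Nat.card A) {g : TwoFun A n}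
    (H : ∀ e : Bool → A, Function.Injective e →
      ∃ h : BoolFun n, h.IsIdempotent ∧ ∀ x, g (TwoTuple.ofBool e x) = e (h x)) :
    g.IsConservative := by
  intro x
  obtain ⟨e, he, y, rfl⟩ := x.exists_eq_ofBool hA
  obtain ⟨h, hi, hh⟩ := H e he
  obtain ⟨i, hi⟩ := hi.exists_apply_eq (rfl : h y = h y)
  exact ⟨i, by rw [hh, ← hi]; rfl⟩

end TwoFun

/-! ### The action of a clone on a pair -/

namespace TwoClass

variable {A : Type*} {G : TwoClass A} {n : ℕ}

/-- All superpositions of conservative functions are defined. -/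
theorem IsTwoClone.exists_comp (hG : G.IsTwoClone) (hc : G.IsConservative) {m : ℕ} {f : TwoFun A m}
    (hf : f ∈ G m) {g : Fin m → TwoFun A n} (hg : ∀ i, g i ∈ G n) :
    ∃ k ∈ G n, ∀ x (y : TwoTuple A m), (∀ i, y.1 i = g i x) → k x = f y := by
  have hd : ∀ x : TwoTuple A n, (Set.range fun i => g i x).ncard ≤ 2 := by
    intro x
    refine (Set.ncard_le_ncard ?_ (Set.finite_range x.1)).trans x.2
    rintro _ ⟨i, rfl⟩
    obtain ⟨j, hj⟩ := hc n _ (hg i) x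
    exact ⟨j, hj.symm⟩
  refine ⟨_, hG.comp_mem m n f g hd hf hg, fun x y hy => ?_⟩
  congr 1
  exact Subtype.ext (funext hy).symm

theorem IsTwoClone.exists_comp₂ (hG : G.IsTwoClone) (hc : G.IsConservative) {f : TwoFun A 2}
    (hf : f ∈ G 2) {g h : TwoFun A n} (hg : g ∈ G n) (hh : h ∈ G n) :
    ∃ k ∈ G n, ∀ x, k x = f (TwoTuple.pair (g x) (h x)) := by
  obtain ⟨k, hk, H⟩ := hG.exists_comp hc hf (g := ![g, h]) (by intro i; fin_cases i <;> assumption)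
  refine ⟨k, hk, fun x => H x _ fun i => ?_⟩
  fin_cases i <;> rfl

/-- The Boolean functions by which the members of `G` act on the pair `{e 0, e 1}`. -/
def restrict (e : Bool → A) (G : TwoClass A) : BoolClass :=
  fun n => {h | ∃ g ∈ G n, g.restrict e = h}

/-- The binary members of `G`, as operations on `A`. -/
def binary (G : TwoClass A) : Set (A → A → A) :=
  {φ | ∃ f ∈ G 2, ∀ a b, φ a b = f (TwoTuple.pair a b)}

theorem isBoolClone_restrict (hG : G.IsTwoClone) (hc : G.IsConservative) {e : Bool → A}
    (he : Function.Injective e) : IsBoolClone (G.restrict e) where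
  proj_mem n i := ⟨_, hG.proj_mem n i, TwoFun.restrict_eq he fun _ => rfl⟩
  comp_mem m n f g := by
    rintro ⟨f, hf, rfl⟩ hg
    choose g' hg' hgg using hg
    obtain ⟨k, hk, H⟩ := hG.exists_comp hc hf hg'
    refine ⟨k, hk, TwoFun.restrict_eq he fun x => ?_⟩
    rw [← (hc m f hf).apply_ofBool e]
    refine H _ _ fun i => ?_
    rw [(hc n _ (hg' i)).apply_ofBool, hgg]
    rfl

theorem isIdempotent_of_mem_restrict (hc : G.IsConservative) {e : Bool → A}
    (he : Function.Injective e) {h : BoolFun n} (hh : h ∈ G.restrict e n) : h.IsIdempotent := by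
  obtain ⟨g, hg, rfl⟩ := hh
  intro c
  apply he
  rw [← (hc n g hg).apply_ofBool e]
  obtain ⟨i, hi⟩ := hc n g hg (TwoTuple.ofBool e fun _ => c)
  exact hi

/-- By symmetry, `G` acts in the same way on all pairs. -/
theorem restrict_subset (hc : G.IsConservative) (hs : G.IsSymmetric) {e e' : Bool → A}
    (he : Function.Injective e) (he' : Function.Injective e') :
    G.restrict e n ⊆ G.restrict e' n := by
  rintro _ ⟨g, hg, rfl⟩
  obtain ⟨σ, h0, h1⟩ := IsSymmBinaryClone.exists_perm₂ (he'.ne Bool.false_ne_true)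
    (he.ne Bool.false_ne_true)
  have hσ : ∀ t, σ (e' t) = e t := fun t => by cases t; exacts [h0, h1]
  refine ⟨_, hs n g hg σ, TwoFun.restrict_eq he' fun x => ?_⟩
  unfold TwoFun.conjBy
  rw [Equiv.symm_apply_eq, hσ, ← (hc n g hg).apply_ofBool e]
  congr 1
  exact Subtype.ext (funext fun i => hσ _)

theorem dual_mem_restrict (hc : G.IsConservative) (hs : G.IsSymmetric) {e : Bool → A}
    (he : Function.Injective e) {h : BoolFun n} (hh : h ∈ G.restrict e n) :
    h.dual ∈ G.restrict e n := by
  have he' : Function.Injective fun t => e (!t) := he.comp Bool.not_injective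
  obtain ⟨g, hg, rfl⟩ := hh
  refine restrict_subset hc hs he' he ⟨g, hg, TwoFun.restrict_eq he' fun x => ?_⟩
  simp only [BoolFun.dual, Bool.not_not, ← (hc n g hg).apply_ofBool]
  rfl

theorem isSymmBinaryClone_binary (hG : G.IsTwoClone) (hc : G.IsConservative)
    (hs : G.IsSymmetric) : IsSymmBinaryClone G.binary where
  fst_mem := ⟨_, hG.proj_mem 2 0, fun _ _ => rfl⟩
  snd_mem := ⟨_, hG.proj_mem 2 1, fun _ _ => rfl⟩
  comp_mem := by
    rintro f ⟨f', hf, Hf⟩ g ⟨g', hg, Hg⟩ h ⟨h', hh, Hh⟩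
    obtain ⟨k, hk, H⟩ := hG.exists_comp₂ hc hf hg hh
    exact ⟨k, hk, fun a b => by simp only [H, Hf, Hg, Hh]⟩
  conservative := by
    rintro f ⟨f', hf, Hf⟩ a b
    obtain ⟨i, hi⟩ := hc 2 f' hf (TwoTuple.pair a b)
    rw [Hf, hi]
    fin_cases i
    exacts [.inl rfl, .inr rfl]
  conj_mem := by
    rintro f ⟨f', hf, Hf⟩ σ
    refine ⟨_, hs 2 f' hf σ, fun a b => ?_⟩
    simp only [TwoFun.conjBy, Hf]
    congr 2
    apply Subtype.ext
    funext i
    fin_cases i <;> rfl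

/-- In the presence of a binary non-projection, which isolates each pair from the others, the actions
of members of `G` on the individual pairs can be glued together. -/
theorem mem_of_restrict_mem [Finite A] (hA : 5 ≤ Nat.card A) (hG : G.IsTwoClone)
    (hc : G.IsConservative) (hs : G.IsSymmetric) (hproj : ∃ g ∈ G 2, ¬ g.IsProjection)
    (hn : 1 ≤ n) {g : TwoFun A n} (hg : g.IsConservative)
    (H : ∀ e : Bool → A, Function.Injective e → g.restrict e ∈ G.restrict e n) : g ∈ G n := by
  classical
  have hB := isSymmBinaryClone_binary hG hc hs
  have hBproj : ∃ φ ∈ G.binary, φ ≠ (fun a _ => a) ∧ φ ≠ (fun _ b => b) := by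
    obtain ⟨f, hf, hfp⟩ := hproj
    refine ⟨fun a b => f (TwoTuple.pair a b), ⟨f, hf, fun _ _ => rfl⟩, fun h => hfp ⟨0, ?_⟩,
      fun h => hfp ⟨1, ?_⟩⟩
    · funext x
      rw [x.eq_pair]
      exact congrFun (congrFun h _) _
    · funext x
      rw [x.eq_pair]
      exact congrFun (congrFun h _) _
  have key : ∀ S : Set (Bool → A), S.Finite → ∃ k ∈ G n, ∀ e ∈ S, Function.Injective e →
      ∀ x, k (TwoTuple.ofBool e x) = g (TwoTuple.ofBool e x) := by
    intro S hS
    induction S, hS using Set.Finite.induction_on with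
    | empty => exact ⟨_, hG.proj_mem n ⟨0, hn⟩, by simp⟩
    | @insert e S _ _ ih =>
      obtain ⟨k₁, hk₁, H₁⟩ := ih
      by_cases he : Function.Injective e
      swap
      · refine ⟨k₁, hk₁, fun e' he' hinj => ?_⟩
        rcases Set.mem_insert_iff.1 he' with rfl | he'
        exacts [absurd hinj he, H₁ e' he' hinj]
      obtain ⟨k₀, hk₀, H₀⟩ := H e he
      have H₀' : ∀ x, k₀ (TwoTuple.ofBool e x) = g (TwoTuple.ofBool e x) := fun x => by
        rw [(hc n k₀ hk₀).apply_ofBool, H₀, hg.apply_ofBool]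
      -- two injections with the same range differ by at most a negation
      have same : ∀ e' : Bool → A, Function.Injective e' →
          ({e' false, e' true} : Set A) = {e false, e true} →
          ∀ x, k₀ (TwoTuple.ofBool e' x) = g (TwoTuple.ofBool e' x) := by
        intro e' he' hr x
        have hx : TwoTuple.ofBool e' x = TwoTuple.ofBool e
            (fun i => decide (e' (x i) = e true)) := by
          apply Subtype.ext
          funext i
          have hm : e' (x i) ∈ ({e false, e true} : Set A) := by
            rw [← hr]; cases x i <;> simp
          simp only [TwoTuple.ofBool]
          rcases hm with h | h
          · rw [h]; simp [he.eq_iff]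
          · rw [h]; simp
        rw [hx, H₀']
      obtain ⟨φ, ⟨f, hf, Hf⟩, f1, f2, f3⟩ :=
        hB.exists_isolating hA hBproj (he.ne Bool.false_ne_true)
      have fidem : ∀ a, φ a a = a := hB.idem ⟨f, hf, Hf⟩
      obtain ⟨k, hk, Hk⟩ := hG.exists_comp₂ hc hf hk₀ hk₁
      refine ⟨k, hk, fun e' he' hinj x => ?_⟩
      rw [Hk, ← Hf]
      by_cases hr : ({e false, e true} : Set A) = {e' false, e' true}
      · rw [same e' hinj hr.symm, (hc n k₁ hk₁).apply_ofBool, hg.apply_ofBool]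
        have hm : ∀ t, e' t = e false ∨ e' t = e true := fun t => by
          have : e' t ∈ ({e false, e true} : Set A) := by rw [hr]; cases t <;> simp
          exact this
        rcases hm (TwoFun.restrict e' g x) with h | h <;>
          rcases hm (TwoFun.restrict e' k₁ x) with h' | h' <;> simp only [h, h', f1, f2, fidem]
      · have he'S : e' ∈ S := (Set.mem_insert_iff.1 he').resolve_left
          fun h => hr (by rw [h])
        rw [H₁ e' he'S hinj, (hc n k₀ hk₀).apply_ofBool, hg.apply_ofBool]
        have hr' : ({e false, e true} : Set A) ≠ {e' true, e' false} := by
          rwa [Set.pair_comm (e' true)]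
        cases TwoFun.restrict e' k₀ x <;> cases TwoFun.restrict e' g x <;>
          simp only [fidem, f3 _ _ hr, f3 _ _ hr']
  obtain ⟨k, hk, Hk⟩ := key Set.univ Set.finite_univ
  have : g = k := by
    funext x
    obtain ⟨e, he, y, rfl⟩ := x.exists_eq_ofBool (by omega)
    exact (Hk e trivial he y).symm
  rwa [this]

/-- In the presence of a binary non-projection, `G` is the free extension of the clone by which it
acts on any one pair. -/
theorem eq_freeExtension [Finite A] (hA : 5 ≤ Nat.card A) (hG : G.IsTwoClone)
    (hc : G.IsConservative) (hs : G.IsSymmetric) (hproj : ∃ g ∈ G 2, ¬ g.IsProjection)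
    {e : Bool → A} (he : Function.Injective e) : G = freeExtension (G.restrict e) A := by
  funext n
  ext g
  constructor
  · intro hg
    refine ⟨hG.arity_pos n g hg, fun b hb => ?_⟩
    have : Finite b := Set.finite_of_ncard_pos (by omega)
    obtain ⟨σ⟩ : Nonempty (b ≃ Bool) := by
      rw [← Finite.card_eq, Nat.card_coe_set_eq, hb]; simp
    exact ⟨_, restrict_subset hc hs (TwoFun.injective_symm σ) he ⟨g, hg, rfl⟩, σ,
      TwoFun.actsAs_iff.2 ((hc n g hg).apply_ofBool _)⟩
  · rintro ⟨hn, hg⟩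
    have H : ∀ e' : Bool → A, Function.Injective e' →
        ∃ h ∈ G.restrict e' n, ∀ x, g (TwoTuple.ofBool e' x) = e' (h x) := by
      intro e' he'
      obtain ⟨b, hb, σ₀, rfl⟩ := TwoFun.exists_equiv he'
      obtain ⟨h, hh, σ, hσ⟩ := hg b hb
      rw [TwoFun.actsAs_iff] at hσ
      have hcomp : ∀ t, (σ.symm (σ (σ₀.symm t)) : A) = σ₀.symm t := by simp
      -- pass from the bijection `σ` to the bijection `σ₀` through a member of `G`
      obtain ⟨k, hk, rfl⟩ := restrict_subset hc hs he (TwoFun.injective_symm σ) hh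
      refine ⟨_, ⟨k, hk, rfl⟩, fun x => ?_⟩
      have hx : TwoTuple.ofBool (fun t => (σ₀.symm t : A)) x =
          TwoTuple.ofBool (fun t => (σ.symm t : A)) (fun i => σ (σ₀.symm (x i))) := by
        apply Subtype.ext
        funext i
        exact (hcomp _).symm
      refine Eq.trans ?_ ((hc n k hk).apply_ofBool (fun t => (σ₀.symm t : A)) x)
      rw [hx, hσ, (hc n k hk).apply_ofBool]
    refine mem_of_restrict_mem hA hG hc hs hproj hn ?_ fun e' he' => ?_
    · refine TwoFun.isConservative_of_restrict (by omega) fun e' he' => ?_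
      obtain ⟨h, hh, H⟩ := H e' he'
      exact ⟨h, isIdempotent_of_mem_restrict hc he' hh, H⟩
    · obtain ⟨h, hh, H⟩ := H e' he'
      rwa [TwoFun.restrict_eq he' H]

/-- If all binary members of `G` are projections, then a member of `G` acts in the same way on all
pairs: each of its values on a pair is a value of a binary minor. -/
theorem restrict_eq_restrict (hG : G.IsTwoClone) (hc : G.IsConservative)
    (hproj : ∀ g ∈ G 2, g.IsProjection) {e e' : Bool → A} (he : Function.Injective e)
    (he' : Function.Injective e') {g : TwoFun A n} (hg : g ∈ G n) :
    g.restrict e = g.restrict e' := by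
  funext x
  obtain ⟨k, hk, H⟩ := hG.exists_comp hc hg
    (g := fun i => TwoFun.proj A (n := 2) (if x i then 1 else 0)) fun i => hG.proj_mem _ _
  obtain ⟨j, rfl⟩ := hproj k hk
  have val : ∀ e : Bool → A, Function.Injective e → g.restrict e x = decide (j = 1) := by
    intro e he
    apply he
    rw [← (hc n g hg).apply_ofBool e,
      ← H (TwoTuple.pair (e false) (e true)) (TwoTuple.ofBool e x) fun i => by
        simp only [TwoTuple.ofBool, TwoFun.proj, TwoTuple.pair]
        cases x i <;> rfl]
    fin_cases j <;> rfl
  rw [val e he, val e' he']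

/-- If all binary members of `G` are projections, then `G` is the dependent extension of the clone
by which it acts on any one pair. -/
theorem eq_dependentExtension [Finite A] (hA : 2 ≤ Nat.card A) (hG : G.IsTwoClone)
    (hc : G.IsConservative) (hproj : ∀ g ∈ G 2, g.IsProjection)
    {e : Bool → A} (he : Function.Injective e) : G = dependentExtension (G.restrict e) A := by
  funext n
  ext g
  constructor
  · intro hg
    refine ⟨hG.arity_pos n g hg, _, ⟨g, hg, rfl⟩, fun b _ σ => TwoFun.actsAs_iff.2 fun x => ?_⟩
    rw [restrict_eq_restrict hG hc hproj he (TwoFun.injective_symm σ) hg]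
    exact (hc n g hg).apply_ofBool _ x
  · rintro ⟨-, h, ⟨k, hk, rfl⟩, H⟩
    have H' : ∀ e' : Bool → A, Function.Injective e' →
        ∀ x, g (TwoTuple.ofBool e' x) = e' (k.restrict e x) := by
      intro e' he'
      obtain ⟨b, hb, σ, rfl⟩ := TwoFun.exists_equiv he'
      exact TwoFun.actsAs_iff.1 (H b hb σ)
    have : g = k := by
      funext x
      obtain ⟨e', he', y, rfl⟩ := x.exists_eq_ofBool hA
      rw [H' e' he', (hc n k hk).apply_ofBool, restrict_eq_restrict hG hc hproj he he' hk]
    rwa [this]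

end TwoClass

/-! ### Classification of the symmetric conservative clones -/

theorem theorem2 {A : Type*} [Finite A] (hA : 5 ≤ Nat.card A) (G : TwoClass A)
    (hclone : G.IsTwoClone) (hcons : G.IsConservative) (hsymm : G.IsSymmetric) :
    ((∃ g ∈ G 2, ¬ g.IsProjection) ∧
      ∃ H ∈ ({PostClass.O1, PostClass.D1, PostClass.D2, PostClass.L4, PostClass.A4,
          PostClass.C4} : Set BoolClass),
        G = TwoClass.freeExtension H A) ∨
    ((∀ g ∈ G 2, g.IsProjection) ∧
      ∃ H ∈ ({PostClass.O1, PostClass.D1, PostClass.D2, PostClass.L4} : Set BoolClass),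
        G = TwoClass.dependentExtension H A) := by
  have : Nontrivial A := Finite.one_lt_card_iff_nontrivial.1 (by omega)
  obtain ⟨p, q, hpq⟩ := exists_pair_ne A
  obtain ⟨e, he⟩ : ∃ e : Bool → A, Function.Injective e :=
    ⟨fun t => cond t q p, fun s t => by cases s <;> cases t <;> simp [hpq, hpq.symm]⟩
  have hK := TwoClass.isBoolClone_restrict hclone hcons he
  have hid : ∀ n, ∀ f ∈ G.restrict e n, f.IsIdempotent := fun n f hf =>
    TwoClass.isIdempotent_of_mem_restrict hcons he hf
  by_cases hproj : ∃ g ∈ G 2, ¬ g.IsProjection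
  · refine .inl ⟨hproj, G.restrict e, ?_,
      TwoClass.eq_freeExtension hA hclone hcons hsymm hproj he⟩
    simp only [Set.mem_insert_iff, Set.mem_singleton_iff]
    by_cases hbin : ∃ f ∈ G.restrict e 2, f ![false, true] = f ![true, false]
    · have := hK.eq_A4_or_C4 hid (fun n f hf => TwoClass.dual_mem_restrict hcons hsymm he hf) hbin
      tauto
    · push Not at hbin
      have := hK.eq_O1_or_D1_or_D2_or_L4 hid hbin
      tauto
  · push Not at hproj
    refine .inr ⟨hproj, G.restrict e, ?_,
      TwoClass.eq_dependentExtension (by omega) hclone hcons hproj he⟩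
    simp only [Set.mem_insert_iff, Set.mem_singleton_iff]
    refine hK.eq_O1_or_D1_or_D2_or_L4 hid ?_
    rintro _ ⟨g, hg, rfl⟩
    obtain ⟨i, rfl⟩ := hproj g hg
    have hr : (TwoFun.proj A i).restrict e = fun x => x i := TwoFun.restrict_eq he fun _ => rfl
    rw [hr]
    fin_cases i <;> simp
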